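/- **Conventions.** A *partial commutative monoid* (PCM) is a set with an element $0$ and a partial binary operation $\ovee$ (write $a\perp b$ if $a\ovee b$ is defined) that is commutative, associative and has unit $0$ in the partial sense; $a\le b$ means $a\ovee c=b$ for some $c$. An *effect algebra* is a PCM with an element $1$ such that each $a$ has a unique $a^\perp$ with $a\ovee a^\perp=1$, and $a\perp 1$ implies $a=0$. An *effectus* (in partial form) is a category $C$ with finite coproducts, with a PCM structure on each homset that is preserved by pre- and postcomposition ($f\perp g$ implies $h\circ f\perp h\circ g$, $f\circ k\perp g\circ k$, $h\circ(f\ovee g)=(h\circ f)\ovee(h\circ g)$ and $(f\ovee g)\circ k=(f\circ k)\ovee(g\circ k)$), such that $[\mathrm{id},0]\circ b\perp[0,\mathrm{id}]\circ b$ for all $b\colon X\to Y+Y$, and $f\perp g$ implies $\kappa_1\circ f\perp\kappa_2\circ g$ for the coprojections $\kappa_i$; together with an object $I$ such that each PCM $\mathrm{Pred}\,X=C(X,I)$ (the *predicates* on $X$) is an effect algebra, with top element $1$, and such that $1\circ f\perp 1\circ g$ implies $f\perp g$, and $1\circ f=0$ implies $f=0$. Let $p$ be a predicate on $X$. - A *quotient*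 for $p$ is a map $\xi\colon X\to Q$ with $1\circ\xi\le p^\perp$ such that each $f\colon X\to Y$ with $1\circ f\le p^\perp$ is $f=f'\circ\xi$ for a unique $f'$. - A *comprehension* for $p$ is a map $\pi\colon E\to X$ with $p\circ\pi=1\circ\pi$ such that each $g\colon Z\to X$ with $p\circ g=1\circ g$ is $g=\pi\circ g'$ for a unique $g'$. We write $\pi_p$ for an arbitrary comprehension for $p$. - A map is *pure* if it is of the form $\pi\circ\xi$ with $\pi$ a comprehension (for some predicate) and $\xi$ a quotient (for some predicate). - The *image* $\mathrm{im}\,f$ of $f\colon X\to Y$ is the least predicate $q$ on $Y$ with $q\circ f=1\circ f$. A predicate is *sharp* if it is the image of some map. - $\lfloor p\rfloor=\mathrm{im}\,\pi_p$ and $\lceil p\rceil=\lfloor p^\perp\rfloor^\perp$. A *$\diamond$-effectus* is an effectus in which every predicate has a quotient and a comprehension, every map has an image, and $s^\perp$ is sharp for every sharp $s$. In it, a map $f\colon X\to Y$ induces maps between sharp predicates $f^\diamond(s)=\lceil s\circ f\rceil$ (for $s$ on $Y$) and $f_\diamond(s)=\mathrm{im}(f\circ\pi_s)$ (for $s$ on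 $X$). Maps $f\colon X\to Y$, $g\colon Y\to X$ are *$\diamond$-adjoint* if $f^\diamond=g_\diamond$; an endomap is *$\diamond$-self-adjoint* if it is $\diamond$-adjoint to itself; a pure endomap $f$ is *$\diamond$-positive* if $f=g\circ g$ for some $\diamond$-self-adjoint $g$. An *$\&$-effectus* is a $\diamond$-effectus such that for each predicate $p$ on each $X$ there is a unique $\diamond$-positive $\mathrm{asrt}_p\colon X\to X$ with $1\circ\mathrm{asrt}_p=p$, and such that $\xi\circ\pi$ is pure for every comprehension $\pi\colon X\to Y$ and quotient $\xi\colon Y\to Z$. In an $\&$-effectus the pure maps form a subcategory $\mathrm{Pure}\,C$ with the same objects as $C$. A map $f$ is *pristine* if it is pure and $1\circ f$ is sharp. A *$\dagger$-category* is a category with an involutive identity-on-objects contravariant functor $(\ )^\dagger$ to itself. In it, an endomap is *$\dagger$-positive* if it is $g^\dagger\circ g$ for some map $g$; a map $f$ is *$\dagger$-mono* if $f^\dagger\circ f=\mathrm{id}$, *$\dagger$-epi* if $f\circ f^\dagger=\mathrm{id}$, and a *$\dagger$-partial isometry* if $f=m\circ e$ with $m$ $\dagger$-mono and $e$ $\dagger$-epi.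 A *$\dagger$-kernel* of $f$ is an equalizer of $f$ with the zero map that is $\dagger$-mono. A *$\dagger$-kernel category* is a $\dagger$-category with a zero object in which every map has a $\dagger$-kernel. A *$\dagger$-effectus* is an $\&$-effectus $C$ with a $\dagger$-category structure on $\mathrm{Pure}\,C$ such that $\mathrm{asrt}_p^\dagger=\mathrm{asrt}_p$ for all predicates $p$, every pure $f$ is $\diamond$-adjoint to $f^\dagger$, for every $\dagger$-positive $f$ there is a unique $\dagger$-positive $g$ with $g\circ g=f$, and all $\diamond$-positive maps are $\dagger$-positive. **Proposition.** Let $C$ be a $\dagger$-effectus. Then for maps $f$ of $\mathrm{Pure}\,C$: 1. $f$ is $\dagger$-mono if and only if $f$ is a comprehension for some predicate; and $f$ is $\dagger$-epi if and only if $f$ is a quotient for some sharp predicate. 2. $f$ is a $\dagger$-partial isometry if and only if $f$ is pristine. Furthermore, $\mathrm{Pure}\,C$ is a $\dagger$-kernel category: for every map $f$ of $\mathrm{Pure}\,C$, every comprehension $\pi_{(1\circ f)^\perp}$ for $(1\circ f)^\perp$ is a $\dagger$-kernel of $f$ in $\mathrm{Pure}\,C$. -/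

import Mathlib

open CategoryTheory CategoryTheory.Limits

universe v u

namespace EffectusTheory

/-! ### Partial commutative monoids and effect algebras -/

/-- A partial commutative monoid.  The partial operation takes values in `Option M`:
`ovee a b = some c` says that the sum of `a` and `b` is defined and equal to `c`. -/
class PCM (M : Type*) where
  zero : M
  ovee : M → M → Option M
  ovee_comm : ∀ a b c : M, ovee a b = some c → ovee b a = some c
  ovee_assoc : ∀ a b c ab abc : M, ovee a b = some ab → ovee ab c = some abc →
    ∃ bc : M, ovee b c = some bc ∧ ovee a bc = some abc
  zero_ovee : ∀ a : M, ovee zero a = some a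

/-- `a ⊥ b`: the sum of `a` and `b` is defined. -/
def Perp {M : Type*} [PCM M] (a b : M) : Prop := ∃ c : M, PCM.ovee a b = some c

/-- The algebraic (pre)order of a partial commutative monoid. -/
def Le {M : Type*} [PCM M] (a b : M) : Prop := ∃ c : M, PCM.ovee a c = some b

/-- An effect algebra structure on a partial commutative monoid: a unit `one` and the
orthocomplement `orth a`, the unique element whose sum with `a` is `one`. -/
class EffectAlgebra (E : Type*) [PCM E] where
  one : E
  orth : E → E
  ovee_orth : ∀ a : E, PCM.ovee a (orth a) = some one
  orth_unique : ∀ a b : E, PCM.ovee a b = some one → b = orth a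
  eq_zero_of_perp_one : ∀ a : E, Perp a one → a = PCM.zero

/-! ### Effectuses in partial form -/

/-- A finPAC: a category with finite coproducts, enriched over partial commutative monoids,
satisfying the compatible sum axiom and the untying axiom. -/
class FinPAC (C : Type u) [Category.{v} C] extends HasFiniteCoproducts C where
  homPCM : ∀ X Y : C, PCM (X ⟶ Y)
  ovee_comp : ∀ {X Y Z : C} (f g k : X ⟶ Y) (h : Y ⟶ Z),
    (homPCM X Y).ovee f g = some k → (homPCM X Z).ovee (f ≫ h) (g ≫ h) = some (k ≫ h)
  comp_ovee : ∀ {W X Y : C} (h : W ⟶ X) (f g k : X ⟶ Y),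
    (homPCM X Y).ovee f g = some k → (homPCM W Y).ovee (h ≫ f) (h ≫ g) = some (h ≫ k)
  compatible_sum : ∀ {X Y : C} (b : X ⟶ Y ⨿ Y),
    Perp (b ≫ coprod.desc (𝟙 Y) (homPCM Y Y).zero) (b ≫ coprod.desc (homPCM Y Y).zero (𝟙 Y))
  untying : ∀ {X Y : C} (f g : X ⟶ Y), Perp f g →
    Perp (f ≫ (coprod.inl : Y ⟶ Y ⨿ Y)) (g ≫ (coprod.inr : Y ⟶ Y ⨿ Y))

attribute [reducible, instance] FinPAC.homPCM

/-- An effectus in partial form: a finPAC with effects.  The object `unit` is the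
distinguished object of which the maps into it are the predicates. -/
class Effectus (C : Type u) [Category.{v} C] extends FinPAC C where
  unit : C
  predEffectAlgebra : ∀ X : C, EffectAlgebra (X ⟶ unit)
  perp_of_perp_one : ∀ {X Y : C} (f g : X ⟶ Y),
    Perp (f ≫ (predEffectAlgebra Y).one) (g ≫ (predEffectAlgebra Y).one) → Perp f g
  eq_zero_of_comp_one : ∀ {X Y : C} (f : X ⟶ Y),
    f ≫ (predEffectAlgebra Y).one = PCM.zero → f = PCM.zero

attribute [reducible, instance] Effectus.predEffectAlgebra

section Basic

variable {C : Type u} [Category.{v} C] [Effectus C]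

/-- Predicates on `X`. -/
abbrev Pred (X : C) := X ⟶ (Effectus.unit : C)

/-- The truth predicate `1` on `X`. -/
def one (X : C) : Pred X := EffectAlgebra.one

/-- The orthocomplement of a predicate. -/
def orth {X : C} (p : Pred X) : Pred X := EffectAlgebra.orth p

/-! ### Quotients, comprehensions, pure maps, images, sharpness -/

/-- `ξ` is a quotient for the predicate `p`. -/
def IsQuotient {X Q : C} (ξ : X ⟶ Q) (p : Pred X) : Prop :=
  Le (ξ ≫ one Q) (orth p) ∧
    ∀ {Y : C} (f : X ⟶ Y), Le (f ≫ one Y) (orth p) → ∃! f' : Q ⟶ Y, ξ ≫ f' = f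

/-- `π` is a comprehension for the predicate `p`. -/
def IsComprehension {E X : C} (π : E ⟶ X) (p : Pred X) : Prop :=
  π ≫ p = π ≫ one X ∧
    ∀ {Z : C} (g : Z ⟶ X), g ≫ p = g ≫ one X → ∃! g' : Z ⟶ E, g' ≫ π = g

/-- A pure map is a quotient followed by a comprehension. -/
def IsPure {X Y : C} (f : X ⟶ Y) : Prop :=
  ∃ (Z : C) (ξ : X ⟶ Z) (π : Z ⟶ Y),
    (∃ p : Pred X, IsQuotient ξ p) ∧ (∃ q : Pred Y, IsComprehension π q) ∧ f = ξ ≫ π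

/-- `p` is the image of `f`: the least predicate `p` with `p ∘ f = 1 ∘ f`. -/
def IsIm {X Y : C} (f : X ⟶ Y) (p : Pred Y) : Prop :=
  f ≫ p = f ≫ one Y ∧ ∀ q : Pred Y, f ≫ q = f ≫ one Y → Le p q

/-- A predicate is sharp if it is the image of some map. -/
def IsSharp {X : C} (p : Pred X) : Prop := ∃ (Z : C) (f : Z ⟶ X), IsIm f p

/-- A map is pristine if it is pure and `1 ∘ f` is sharp. -/
def IsPristine {X Y : C} (f : X ⟶ Y) : Prop := IsPure f ∧ IsSharp (f ≫ one Y)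

end Basic

/-- An effectus with quotients. -/
class HasQuotients (C : Type u) [Category.{v} C] [Effectus C] : Prop where
  exists_quotient : ∀ {X : C} (p : Pred X), ∃ (Q : C) (ξ : X ⟶ Q), IsQuotient ξ p

/-- An effectus with comprehension. -/
class HasComprehension (C : Type u) [Category.{v} C] [Effectus C] : Prop where
  exists_comprehension : ∀ {X : C} (p : Pred X), ∃ (E : C) (π : E ⟶ X), IsComprehension π p

/-- An effectus with images. -/
class HasIm (C : Type u) [Category.{v} C] [Effectus C] : Prop where
  exists_im : ∀ {X Y : C} (f : X ⟶ Y), ∃ p : Pred Y, IsIm f p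

/-- A `◇`-effectus. -/
class IsDiamondEffectus (C : Type u) [Category.{v} C] [Effectus C] : Prop
    extends HasQuotients C, HasComprehension C, HasIm C where
  isSharp_orth : ∀ {X : C} (s : Pred X), IsSharp s → IsSharp (orth s)

/-! ### The operations `f^◇` and `f_◇` -/

section Diamond

variable {C : Type u} [Category.{v} C] [Effectus C]

/-- The image of a map. -/
noncomputable def im [HasIm C] {X Y : C} (f : X ⟶ Y) : Pred Y :=
  (HasIm.exists_im f).choose

theorem isIm_im [HasIm C] {X Y : C} (f : X ⟶ Y) : IsIm f (im f) :=
  (HasIm.exists_im f).choose_spec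

theorem isSharp_im [HasIm C] {X Y : C} (f : X ⟶ Y) : IsSharp (im f) := ⟨X, f, isIm_im f⟩

/-- The domain of a chosen comprehension `compr p` of `p`. -/
noncomputable def comprObj [HasComprehension C] {X : C} (p : Pred X) : C :=
  (HasComprehension.exists_comprehension p).choose

/-- A chosen comprehension `π_p` of `p`. -/
noncomputable def compr [HasComprehension C] {X : C} (p : Pred X) : comprObj p ⟶ X :=
  (HasComprehension.exists_comprehension p).choose_spec.choose

theorem isComprehension_compr [HasComprehension C] {X : C} (p : Pred X) :
    IsComprehension (compr p) p :=
  (HasComprehension.exists_comprehension p).choose_spec.choose_spec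

/-- `⌊p⌋`, the image of a comprehension of `p`. -/
noncomputable def floor [HasComprehension C] [HasIm C] {X : C} (p : Pred X) : Pred X :=
  im (compr p)

/-- `⌈p⌉ = ⌊p^⊥⌋^⊥`. -/
noncomputable def ceil [HasComprehension C] [HasIm C] {X : C} (p : Pred X) : Pred X :=
  orth (floor (orth p))

/-- The sharp predicates on `X`. -/
abbrev SPred (X : C) := {s : Pred X // IsSharp s}

variable [IsDiamondEffectus C]

/-- `f^◇(s) = ⌈s ∘ f⌉`. -/
noncomputable def diaUp {X Y : C} (f : X ⟶ Y) (s : SPred Y) : SPred X :=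
  ⟨ceil (f ≫ s.1), IsDiamondEffectus.isSharp_orth _ (isSharp_im _)⟩

/-- `f_◇(s) = im (f ∘ π_s)`. -/
noncomputable def diaDown {X Y : C} (f : X ⟶ Y) (s : SPred X) : SPred Y :=
  ⟨im (compr s.1 ≫ f), isSharp_im _⟩

/-- `f` and `g` are `◇`-adjoint. -/
def DiaAdjoint {X Y : C} (f : X ⟶ Y) (g : Y ⟶ X) : Prop := diaUp f = diaDown g

/-- An endomap is `◇`-self-adjoint if it is `◇`-adjoint to itself. -/
def DiaSelfAdjoint {X : C} (f : X ⟶ X) : Prop := DiaAdjoint f f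

/-- A pure endomap is `◇`-positive if it is the square of a `◇`-self-adjoint map. -/
def DiaPositive {X : C} (f : X ⟶ X) : Prop :=
  IsPure f ∧ ∃ g : X ⟶ X, DiaSelfAdjoint g ∧ f = g ≫ g

end Diamond

/-! ### `&`-effectuses -/

/-- An `&`-effectus. -/
class IsAndthenEffectus (C : Type u) [Category.{v} C] [Effectus C] : Prop
    extends IsDiamondEffectus C where
  existsUnique_asrt : ∀ {X : C} (p : Pred X), ∃! f : X ⟶ X, DiaPositive f ∧ f ≫ one X = p
  isPure_comprehension_comp_quotient : ∀ {X Y Z : C} (π : X ⟶ Y) (ξ : Y ⟶ Z)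
    (p q : Pred Y), IsComprehension π p → IsQuotient ξ q → IsPure (π ≫ ξ)

/-- `asrt_p`, the unique `◇`-positive map with `1 ∘ asrt_p = p`. -/
noncomputable def asrt {C : Type u} [Category.{v} C] [Effectus C] [IsAndthenEffectus C]
    {X : C} (p : Pred X) : X ⟶ X :=
  (IsAndthenEffectus.existsUnique_asrt p).choose

theorem asrt_spec {C : Type u} [Category.{v} C] [Effectus C] [IsAndthenEffectus C]
    {X : C} (p : Pred X) : DiaPositive (asrt p) ∧ asrt p ≫ one X = p :=
  (IsAndthenEffectus.existsUnique_asrt p).choose_spec.1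

/-! ### Pure maps form a subcategory -/

section PCMLemmas

variable {E : Type*} [PCM E]

theorem Le.refl (a : E) : Le a a :=
  ⟨PCM.zero, PCM.ovee_comm _ _ _ (PCM.zero_ovee a)⟩

theorem Le.trans {a b c : E} (h₁ : Le a b) (h₂ : Le b c) : Le a c := by
  obtain ⟨x, hx⟩ := h₁
  obtain ⟨y, hy⟩ := h₂
  obtain ⟨z, -, hz⟩ := PCM.ovee_assoc _ _ _ _ _ hx hy
  exact ⟨z, hz⟩

variable [EffectAlgebra E]

theorem ovee_cancel {a b c d : E} (h₁ : PCM.ovee a b = some d) (h₂ : PCM.ovee a c = some d) :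
    b = c := by
  have key : ∀ {x : E}, PCM.ovee a x = some d →
      PCM.ovee x (EffectAlgebra.orth x) = some (EffectAlgebra.one : E) ∧
      ∃ y, PCM.ovee a (EffectAlgebra.orth d) = some y ∧
        PCM.ovee y x = some (EffectAlgebra.one : E) := by
    intro x hx
    obtain ⟨y, hy, hy'⟩ := PCM.ovee_assoc _ _ _ _ _ (PCM.ovee_comm _ _ _ hx)
      (EffectAlgebra.ovee_orth d)
    exact ⟨EffectAlgebra.ovee_orth x, y, hy, PCM.ovee_comm _ _ _ hy'⟩
  obtain ⟨-, y, hy, hyb⟩ := key h₁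
  obtain ⟨-, z, hz, hzc⟩ := key h₂
  obtain rfl : y = z := Option.some.inj (hy.symm.trans hz)
  rw [EffectAlgebra.orth_unique _ _ hyb, EffectAlgebra.orth_unique _ _ hzc]

theorem eq_zero_of_ovee_eq_zero {a b : E} (h : PCM.ovee a b = some PCM.zero) : b = PCM.zero := by
  obtain ⟨c, hc, -⟩ := PCM.ovee_assoc _ _ _ _ _ h (PCM.zero_ovee (EffectAlgebra.one : E))
  exact EffectAlgebra.eq_zero_of_perp_one _ ⟨c, hc⟩

theorem Le.antisymm {a b : E} (h₁ : Le a b) (h₂ : Le b a) : a = b := by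
  obtain ⟨x, hx⟩ := h₁
  obtain ⟨y, hy⟩ := h₂
  obtain ⟨z, hz, hz'⟩ := PCM.ovee_assoc _ _ _ _ _ hx hy
  have h0 : PCM.ovee a PCM.zero = some a := PCM.ovee_comm _ _ _ (PCM.zero_ovee a)
  obtain rfl := ovee_cancel hz' h0
  obtain rfl := eq_zero_of_ovee_eq_zero (PCM.ovee_comm _ _ _ hz)
  exact Option.some.inj (h0.symm.trans hx)

end PCMLemmas

section PureLemmas

variable {C : Type u} [Category.{v} C] [Effectus C]

theorem le_one {X : C} (p : Pred X) : Le p (one X) := ⟨_, EffectAlgebra.ovee_orth p⟩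

theorem Le.comp {X Y : C} (f : X ⟶ Y) {p q : Pred Y} (h : Le p q) : Le (f ≫ p) (f ≫ q) := by
  obtain ⟨c, hc⟩ := h
  exact ⟨f ≫ c, FinPAC.comp_ovee _ _ _ _ hc⟩

theorem orth_orth {X : C} (p : Pred X) : orth (orth p) = p :=
  (EffectAlgebra.orth_unique _ _ (PCM.ovee_comm _ _ _ (EffectAlgebra.ovee_orth p))).symm

theorem orth_zero {X : C} : orth (PCM.zero : Pred X) = one X :=
  (EffectAlgebra.orth_unique _ _ (PCM.zero_ovee _)).symm

theorem one_unit : one (Effectus.unit : C) = 𝟙 (Effectus.unit : C) := by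
  apply Le.antisymm _ (le_one _)
  obtain ⟨c, hc⟩ := le_one (𝟙 (Effectus.unit : C))
  have h := FinPAC.ovee_comp _ _ _ (one (Effectus.unit : C)) hc
  rw [Category.id_comp] at h
  have h1 : Le (one (Effectus.unit : C) ≫ one (Effectus.unit : C)) (one (Effectus.unit : C)) :=
    le_one _
  have h2 : Le (one (Effectus.unit : C)) (one (Effectus.unit : C) ≫ one (Effectus.unit : C)) :=
    ⟨_, h⟩
  have h3 := Le.antisymm h1 h2
  rw [h3] at h
  have h4 : c ≫ one (Effectus.unit : C) = PCM.zero :=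
    ovee_cancel h (PCM.ovee_comm _ _ _ (PCM.zero_ovee _))
  have h5 := Effectus.eq_zero_of_comp_one c h4
  subst h5
  have h6 := (PCM.ovee_comm _ _ _ hc).symm.trans (PCM.zero_ovee _)
  rw [Option.some.inj h6]
  exact Le.refl _

theorem isComprehension_id (X : C) : IsComprehension (𝟙 X) (one X) :=
  ⟨rfl, fun g _ => ⟨g, Category.comp_id g, fun y hy => by simpa using hy⟩⟩

theorem isQuotient_id (X : C) : IsQuotient (𝟙 X) (PCM.zero : Pred X) := by
  refine ⟨?_, fun f _ => ⟨f, Category.id_comp f, fun y hy => by simpa using hy⟩⟩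
  rw [orth_zero]
  exact le_one _

theorem IsQuotient.isPure {X Y : C} {f : X ⟶ Y} {p : Pred X} (h : IsQuotient f p) : IsPure f :=
  ⟨Y, f, 𝟙 Y, ⟨p, h⟩, ⟨_, isComprehension_id Y⟩, (Category.comp_id f).symm⟩

theorem IsComprehension.isPure {X Y : C} {f : X ⟶ Y} {p : Pred Y} (h : IsComprehension f p) :
    IsPure f :=
  ⟨X, 𝟙 X, f, ⟨_, isQuotient_id X⟩, ⟨p, h⟩, (Category.id_comp f).symm⟩

theorem isPure_id (X : C) : IsPure (𝟙 X) := (isComprehension_id X).isPure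

theorem IsQuotient.one_eq {X Q : C} {ξ : X ⟶ Q} {p : Pred X} (h : IsQuotient ξ p) :
    ξ ≫ one Q = orth p := by
  refine Le.antisymm h.1 ?_
  obtain ⟨g, hg, -⟩ := h.2 (orth p) (by rw [one_unit, Category.comp_id]; exact Le.refl _)
  rw [← hg]
  exact (le_one g).comp ξ

theorem IsQuotient.cancel {X Q Y : C} {ξ : X ⟶ Q} {p : Pred X} (h : IsQuotient ξ p)
    {f g : Q ⟶ Y} (hfg : ξ ≫ f = ξ ≫ g) : f = g := by
  have hle : Le ((ξ ≫ g) ≫ one Y) (orth p) := by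
    rw [Category.assoc]
    exact ((le_one (g ≫ one Y)).comp ξ).trans h.1
  exact (h.2 (ξ ≫ g) hle).unique hfg rfl

theorem IsComprehension.cancel {E X Z : C} {π : E ⟶ X} {p : Pred X} (h : IsComprehension π p)
    {f g : Z ⟶ E} (hfg : f ≫ π = g ≫ π) : f = g :=
  (h.2 (g ≫ π) (by rw [Category.assoc, h.1, Category.assoc])).unique hfg rfl

/-- Quotients are stable under postcomposition with isomorphisms. -/
theorem IsQuotient.comp_iso {X Q R : C} {ξ : X ⟶ Q} {p : Pred X} (h : IsQuotient ξ p)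
    {g : Q ⟶ R} {k : R ⟶ Q} (hgk : g ≫ k = 𝟙 Q) (hkg : k ≫ g = 𝟙 R) :
    IsQuotient (ξ ≫ g) p := by
  refine ⟨?_, fun f hf => ?_⟩
  · rw [Category.assoc]
    exact ((le_one (g ≫ one R)).comp ξ).trans h.1
  · obtain ⟨f', hf', -⟩ := h.2 f hf
    refine ⟨k ≫ f', ?_, fun y hy => ?_⟩
    · show (ξ ≫ g) ≫ k ≫ f' = f
      rw [Category.assoc, ← Category.assoc g, hgk, Category.id_comp, hf']
    · have hy' : g ≫ y = f' := h.cancel (by rw [← Category.assoc]; exact hy.trans hf'.symm)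
      rw [← hy', ← Category.assoc, hkg, Category.id_comp]

theorem isQuotient_comp [HasQuotients C] {X Y Z : C} {ξ₁ : X ⟶ Y} {ξ₂ : Y ⟶ Z} {p : Pred X}
    {q : Pred Y} (h₁ : IsQuotient ξ₁ p) (h₂ : IsQuotient ξ₂ q) :
    ∃ r : Pred X, IsQuotient (ξ₁ ≫ ξ₂) r := by
  obtain ⟨Q, ξ, hξ⟩ := HasQuotients.exists_quotient (orth (ξ₁ ≫ orth q))
  have hone : ξ ≫ one Q = ξ₁ ≫ orth q := by rw [hξ.one_eq, orth_orth]
  obtain ⟨k₁, hk₁, -⟩ := h₁.2 ξ (by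
    rw [hone, ← h₁.one_eq]; exact (le_one _).comp ξ₁)
  have hk₁one : k₁ ≫ one Q = orth q := by
    apply h₁.cancel
    rw [← Category.assoc, hk₁, hone]
  obtain ⟨k₂, hk₂, -⟩ := h₂.2 k₁ (by rw [hk₁one]; exact Le.refl _)
  obtain ⟨g, hg, -⟩ := hξ.2 (ξ₁ ≫ ξ₂) (by
    rw [orth_orth, Category.assoc, h₂.one_eq]; exact Le.refl _)
  have hgk : g ≫ k₂ = 𝟙 Q := by
    apply hξ.cancel
    rw [← Category.assoc, hg, Category.assoc, hk₂, hk₁, Category.comp_id]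
  have hkg : k₂ ≫ g = 𝟙 Z := by
    apply h₂.cancel
    rw [← Category.assoc, hk₂, Category.comp_id]
    apply h₁.cancel
    rw [← Category.assoc, hk₁, hg]
  exact ⟨_, hg ▸ hξ.comp_iso hgk hkg⟩

theorem IsComprehension.total [HasQuotients C] {E X : C} {π : E ⟶ X} {p : Pred X}
    (h : IsComprehension π p) : π ≫ one X = one E := by
  obtain ⟨Q, ξ, hξ⟩ := HasQuotients.exists_quotient (orth (π ≫ one X))
  have hone : ξ ≫ one Q = π ≫ one X := by rw [hξ.one_eq, orth_orth]
  obtain ⟨t, ht, -⟩ := hξ.2 π (by rw [orth_orth]; exact Le.refl _)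
  have htp : t ≫ p = t ≫ one X := by
    apply hξ.cancel
    rw [← Category.assoc, ht, h.1, ← ht, Category.assoc]
  obtain ⟨f, hf, -⟩ := h.2 t htp
  have hid : ξ ≫ f = 𝟙 E := by
    apply h.cancel
    rw [Category.assoc, hf, ht, Category.id_comp]
  apply Le.antisymm (le_one _)
  rw [← hone]
  have := (le_one (f ≫ one E)).comp ξ
  rwa [← Category.assoc, hid, Category.id_comp] at this

theorem exists_retraction [IsAndthenEffectus C] {E X : C} {π : E ⟶ X} {p : Pred X}
    (h : IsComprehension π p) : ∃ ζ : X ⟶ E, π ≫ ζ = 𝟙 E := by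
  obtain ⟨Q, ξ, hξ⟩ := HasQuotients.exists_quotient (orth (im π))
  have hone : ξ ≫ one Q = im π := by rw [hξ.one_eq, orth_orth]
  obtain ⟨Z, ξ', π', ⟨p', hξ'⟩, ⟨q', hπ'⟩, hfac⟩ :=
    IsAndthenEffectus.isPure_comprehension_comp_quotient π ξ p _ h hξ
  -- the quotient part of `π ≫ ξ` is a split mono with retraction `k`
  have htot : ξ' ≫ one Z = one E := by
    rw [← hπ'.total, ← Category.assoc, ← hfac, Category.assoc, hone, (isIm_im π).1, h.total]
  obtain ⟨k, hk, -⟩ := hξ'.2 (𝟙 E) (by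
    rw [Category.id_comp, ← hξ'.one_eq, htot]; exact Le.refl _)
  -- the comprehension part of `π ≫ ξ` is a split epi with section `m`
  have hq : ξ ≫ q' = ξ ≫ one Q := by
    apply Le.antisymm ((le_one q').comp ξ)
    rw [hone]
    refine (isIm_im π).2 _ ?_
    rw [← Category.assoc, hfac, Category.assoc, hπ'.1, ← Category.assoc, ← hfac,
      Category.assoc, hone, (isIm_im π).1]
  have hq' : q' = one Q := hξ.cancel hq
  obtain ⟨m, hm, -⟩ := hπ'.2 (𝟙 Q) (by rw [hq'])
  have hm' : π' ≫ m = 𝟙 Z := by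
    apply hπ'.cancel
    rw [Category.assoc, hm, Category.comp_id, Category.id_comp]
  refine ⟨ξ ≫ m ≫ k, ?_⟩
  rw [← Category.assoc, hfac, Category.assoc, ← Category.assoc π', hm', Category.id_comp, hk]

theorem isComprehension_comp [IsAndthenEffectus C] {X Y Z : C} {π₁ : X ⟶ Y} {π₂ : Y ⟶ Z}
    {p₁ : Pred Y} {p₂ : Pred Z} (h₁ : IsComprehension π₁ p₁) (h₂ : IsComprehension π₂ p₂) :
    ∃ q : Pred Z, IsComprehension (π₁ ≫ π₂) q := by
  obtain ⟨ζ, hζ⟩ := exists_retraction h₂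
  have hw := isIm_im (π₁ ≫ π₂)
  refine ⟨im (π₁ ≫ π₂), hw.1, fun {W} f hf => ?_⟩
  have hle₂ : Le (im (π₁ ≫ π₂)) p₂ :=
    hw.2 _ (by rw [Category.assoc, h₂.1, Category.assoc])
  have hle₁ : Le (im (π₁ ≫ π₂)) (ζ ≫ p₁) := by
    refine hw.2 _ ?_
    rw [Category.assoc, ← Category.assoc π₂, hζ, Category.id_comp, h₁.1, Category.assoc, h₂.total]
  obtain ⟨g₂, hg₂, -⟩ := h₂.2 f
    (Le.antisymm ((le_one p₂).comp f) (by rw [← hf]; exact hle₂.comp f))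
  have hg₂p : g₂ ≫ p₁ = g₂ ≫ one Y := by
    apply Le.antisymm ((le_one p₁).comp g₂)
    have h := hle₁.comp f
    rwa [hf, ← hg₂, Category.assoc, h₂.total, Category.assoc, ← Category.assoc π₂, hζ,
      Category.id_comp] at h
  obtain ⟨g₁, hg₁, -⟩ := h₁.2 g₂ hg₂p
  refine ⟨g₁, ?_, fun y hy => ?_⟩
  · show g₁ ≫ π₁ ≫ π₂ = f
    rw [← Category.assoc, hg₁, hg₂]
  apply h₁.cancel
  apply h₂.cancel
  rw [hg₁, hg₂, Category.assoc]
  exact hy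

theorem IsPure.comp [IsAndthenEffectus C] {X Y Z : C} {f : X ⟶ Y} {g : Y ⟶ Z} (hf : IsPure f)
    (hg : IsPure g) : IsPure (f ≫ g) := by
  obtain ⟨A, ξ₁, π₁, ⟨p₁, hξ₁⟩, ⟨q₁, hπ₁⟩, rfl⟩ := hf
  obtain ⟨B, ξ₂, π₂, ⟨p₂, hξ₂⟩, ⟨q₂, hπ₂⟩, rfl⟩ := hg
  obtain ⟨D, ξ, π, ⟨p, hξ⟩, ⟨q, hπ⟩, hfac⟩ :=
    IsAndthenEffectus.isPure_comprehension_comp_quotient π₁ ξ₂ q₁ p₂ hπ₁ hξ₂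
  refine ⟨D, ξ₁ ≫ ξ, π ≫ π₂, isQuotient_comp hξ₁ hξ, isComprehension_comp hπ hπ₂, ?_⟩
  rw [Category.assoc, ← Category.assoc π₁, hfac]
  simp only [Category.assoc]

end PureLemmas

/-- The property of being a pure map. -/
def pureMaps (C : Type u) [Category.{v} C] [Effectus C] : MorphismProperty C :=
  fun _ _ f => IsPure f

instance (C : Type u) [Category.{v} C] [Effectus C] [IsAndthenEffectus C] :
    (pureMaps C).IsMultiplicative where
  id_mem X := isPure_id X
  comp_mem _ _ hf hg := IsPure.comp hf hg

/-- The category `Pure C` of pure maps of an `&`-effectus: the objects are those of `C`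
and the maps are the pure maps of `C`. -/
abbrev PureCat (C : Type u) [Category.{v} C] [Effectus C] [IsAndthenEffectus C] :=
  WideSubcategory (pureMaps C)

/-- A pure map of `C` as a map of `Pure C`. -/
def PureCat.homMk {C : Type u} [Category.{v} C] [Effectus C] [IsAndthenEffectus C]
    {X Y : PureCat C} (f : X.obj ⟶ Y.obj) (hf : IsPure f) : X ⟶ Y := ⟨f, hf⟩

/-! ### Dagger categories -/

/-- A dagger category: an involutive identity-on-objects contravariant endofunctor. -/
class DaggerCategory (D : Type u) [Category.{v} D] where
  dagger : ∀ {X Y : D}, (X ⟶ Y) → (Y ⟶ X)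
  dagger_comp : ∀ {X Y Z : D} (f : X ⟶ Y) (g : Y ⟶ Z),
    dagger (f ≫ g) = dagger g ≫ dagger f
  dagger_id : ∀ X : D, dagger (𝟙 X) = 𝟙 X
  dagger_dagger : ∀ {X Y : D} (f : X ⟶ Y), dagger (dagger f) = f

section Dagger

variable {D : Type u} [Category.{v} D]

open DaggerCategory

/-- An endomap is `†`-positive if it is `g† ∘ g` for some map `g`. -/
def DaggerPositive [DaggerCategory D] {X : D} (f : X ⟶ X) : Prop :=
  ∃ (Y : D) (g : X ⟶ Y), f = g ≫ dagger g

/-- `f` is `†`-mono: `f† ∘ f = id`. -/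
def DaggerMono [DaggerCategory D] {X Y : D} (f : X ⟶ Y) : Prop := f ≫ dagger f = 𝟙 X

/-- `f` is `†`-epi: `f ∘ f† = id`. -/
def DaggerEpi [DaggerCategory D] {X Y : D} (f : X ⟶ Y) : Prop := dagger f ≫ f = 𝟙 Y

/-- A `†`-partial isometry is a `†`-epi followed by a `†`-mono. -/
def DaggerPartialIsometry [DaggerCategory D] {X Y : D} (f : X ⟶ Y) : Prop :=
  ∃ (Z : D) (e : X ⟶ Z) (m : Z ⟶ Y), DaggerEpi e ∧ DaggerMono m ∧ f = e ≫ m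

/-- A zero map: a map that factors through a zero object. -/
def IsZeroMap {X Y : D} (f : X ⟶ Y) : Prop :=
  ∃ (Z : D) (a : X ⟶ Z) (b : Z ⟶ Y), IsZero Z ∧ f = a ≫ b

/-- `k` is a `†`-kernel of `f`: a `†`-mono equalizer of `f` with the zero map. -/
def IsDaggerKernel [DaggerCategory D] {K X Y : D} (f : X ⟶ Y) (k : K ⟶ X) : Prop :=
  DaggerMono k ∧ ∃ z : X ⟶ Y, IsZeroMap z ∧ ∃ w : k ≫ f = k ≫ z, Nonempty (IsLimit (Fork.ofι k w))

end Dagger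

/-- A `†`-kernel category: a dagger category with a zero object in which every map has
a `†`-kernel. -/
def IsDaggerKernelCategory (D : Type u) [Category.{v} D] [DaggerCategory D] : Prop :=
  HasZeroObject D ∧ ∀ {X Y : D} (f : X ⟶ Y), ∃ (K : D) (k : K ⟶ X), IsDaggerKernel f k

/-! ### Dagger effectuses -/

/-- A `†`-effectus: an `&`-effectus with a dagger on its category of pure maps. -/
class DaggerEffectus (C : Type u) [Category.{v} C] [Effectus C] extends IsAndthenEffectus C where
  daggerCategory : DaggerCategory (PureCat C)
  dagger_asrt : ∀ {X : PureCat C} (p : Pred X.obj),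
    daggerCategory.dagger (PureCat.homMk (X := X) (Y := X) (asrt p) (asrt_spec p).1.1) =
      PureCat.homMk (X := X) (Y := X) (asrt p) (asrt_spec p).1.1
  diaAdjoint_dagger : ∀ {X Y : PureCat C} (f : X ⟶ Y),
    DiaAdjoint f.hom (daggerCategory.dagger f).hom
  existsUnique_sqrt : ∀ {X : PureCat C} (f : X ⟶ X), DaggerPositive f →
    ∃! g : X ⟶ X, DaggerPositive g ∧ g ≫ g = f
  daggerPositive_of_diaPositive : ∀ {X : PureCat C} (f : X ⟶ X), DiaPositive f.hom →
    DaggerPositive f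

attribute [reducible, instance] DaggerEffectus.daggerCategory

end EffectusTheory

open EffectusTheory

/-! The hinge is that the identity is the only total `†`-positive endomap. A `†`-positive map has a
`†`-positive square root, which is its own dagger and hence `◇`-self-adjoint, so the map is
`◇`-positive; uniqueness of `asrt` for the predicate `1` then forces a total one to be the identity
(`DaggerPositive.eq_id`).

For a comprehension `π` the map `π† ∘ π` is `†`-positive, so `π` is `†`-mono once this composite is
total. Totality follows from `1 ∘ π† = im π` (`dagger_comp_one_of_isComprehension`), which combines
`◇`-adjointness of a pure map and its dagger with a retraction of `π` that is a quotient for `(im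
π)^⊥`. Conversely a `†`-mono is split, hence total, and a total pure map is a comprehension because
its quotient factor is invertible.

The other claims transfer this through the dagger: `π†` is itself a quotient for `(im π)^⊥`
(`dagger_eq_quotient_comp_iso`), which identifies the `†`-epis. Pristine maps are then the
composites of the two classes, and `π†` supplies the pure factorizations that make a comprehension
for `(1 ∘ f)^⊥` a kernel. -/

namespace EffectusTheory

open DaggerCategory

/-! ### Zero maps and the order on predicates -/

section Predicates

variable {C : Type u} [Category.{v} C] [Effectus C]

theorem eq_zero_of_ovee_self {E : Type*} [PCM E] [EffectAlgebra E] {a : E}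
    (h : PCM.ovee a a = some a) : a = PCM.zero :=
  ovee_cancel h (PCM.ovee_comm _ _ _ (PCM.zero_ovee a))

/-- Composition is only assumed to preserve defined sums, not `0`. But `0 ⊕ 0 = 0` makes the
composite equal to its own double, and predicates cancel. -/
theorem comp_zero_pred {X Y : C} (f : X ⟶ Y) : f ≫ (PCM.zero : Pred Y) = PCM.zero :=
  eq_zero_of_ovee_self (FinPAC.comp_ovee f _ _ _ (PCM.zero_ovee _))

theorem zero_comp_pred {X Y : C} (p : Pred Y) : (PCM.zero : X ⟶ Y) ≫ p = PCM.zero :=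
  eq_zero_of_ovee_self (FinPAC.ovee_comp _ _ _ p (PCM.zero_ovee _))

theorem comp_zero {X Y Z : C} (f : X ⟶ Y) : f ≫ (PCM.zero : Y ⟶ Z) = PCM.zero := by
  apply Effectus.eq_zero_of_comp_one
  rw [Category.assoc, zero_comp_pred, comp_zero_pred]

theorem zero_comp {X Y Z : C} (f : Y ⟶ Z) : (PCM.zero : X ⟶ Y) ≫ f = PCM.zero := by
  apply Effectus.eq_zero_of_comp_one
  rw [Category.assoc, zero_comp_pred]

theorem comp_ovee_orth {X Y : C} (f : X ⟶ Y) (p : Pred Y) :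
    PCM.ovee (f ≫ p) (f ≫ orth p) = some (f ≫ one Y) :=
  FinPAC.comp_ovee f _ _ _ (EffectAlgebra.ovee_orth p)

/-- `f` factors through `p^⊥` precisely if `p ∘ f = 0`. -/
theorem comp_orth_eq_one_iff {X Y : C} (f : X ⟶ Y) (p : Pred Y) :
    f ≫ orth p = f ≫ one Y ↔ f ≫ p = PCM.zero := by
  have h := comp_ovee_orth f p
  constructor <;> intro h'
  · rw [h'] at h
    exact ovee_cancel (PCM.ovee_comm _ _ _ h) (PCM.ovee_comm _ _ _ (PCM.zero_ovee _))
  · rw [h', PCM.zero_ovee] at h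
    exact Option.some.inj h

theorem Le.orth {X : C} {p q : Pred X} (h : Le p q) :
    Le (EffectusTheory.orth q) (EffectusTheory.orth p) := by
  obtain ⟨c, hc⟩ := h
  obtain ⟨d, hd, hd'⟩ := PCM.ovee_assoc _ _ _ _ _ hc (EffectAlgebra.ovee_orth q)
  obtain rfl := EffectAlgebra.orth_unique _ _ hd'
  exact ⟨c, PCM.ovee_comm _ _ _ hd⟩

theorem total_of_comp_total {X Y Z : C} {f : X ⟶ Y} {g : Y ⟶ Z}
    (h : (f ≫ g) ≫ one Z = one X) : f ≫ one Y = one X := by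
  apply Le.antisymm (le_one _)
  rw [← h, Category.assoc]
  exact (le_one _).comp f

end Predicates

/-! ### Comprehensions and quotients that are invertible -/

section Isomorphisms

variable {C : Type u} [Category.{v} C] [Effectus C]

theorem isComprehension_of_inverse {X Y : C} {f : X ⟶ Y} {g : Y ⟶ X} (hfg : f ≫ g = 𝟙 X)
    (hgf : g ≫ f = 𝟙 Y) : IsComprehension f (one Y) :=
  ⟨rfl, fun h _ => ⟨h ≫ g, by simp [hgf], fun y hy => by
    rw [← hy, Category.assoc, hfg, Category.comp_id]⟩⟩

theorem IsComprehension.iso_comp {X Y Z : C} {f : X ⟶ Y} {g : Y ⟶ X} {π : Y ⟶ Z} {p : Pred Z}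
    (hfg : f ≫ g = 𝟙 X) (hgf : g ≫ f = 𝟙 Y) (h : IsComprehension π p) :
    IsComprehension (f ≫ π) p := by
  refine ⟨by rw [Category.assoc, h.1, Category.assoc], fun k hk => ?_⟩
  obtain ⟨l, hl, -⟩ := h.2 k hk
  refine ⟨l ≫ g, ?_, fun y hy => ?_⟩
  · show (l ≫ g) ≫ f ≫ π = k
    rw [Category.assoc, ← Category.assoc g, hgf, Category.id_comp, hl]
  · have hy' : y ≫ f = l := h.cancel (by rw [Category.assoc]; exact hy.trans hl.symm)
    rw [← hy', Category.assoc, hfg, Category.comp_id]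

/-- A comprehension of the truth predicate is an isomorphism. -/
theorem IsComprehension.exists_inverse {X Y : C} {π : X ⟶ Y} (h : IsComprehension π (one Y)) :
    ∃ g : Y ⟶ X, π ≫ g = 𝟙 X ∧ g ≫ π = 𝟙 Y := by
  obtain ⟨g, hg, -⟩ := h.2 (𝟙 Y) rfl
  exact ⟨g, h.cancel (by rw [Category.assoc, hg, Category.comp_id, Category.id_comp]), hg⟩

/-- A total quotient is an isomorphism. -/
theorem IsQuotient.exists_inverse {X Y : C} {ξ : X ⟶ Y} {p : Pred X} (h : IsQuotient ξ p)
    (hξ : ξ ≫ one Y = one X) : ∃ g : Y ⟶ X, ξ ≫ g = 𝟙 X ∧ g ≫ ξ = 𝟙 Y := by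
  obtain ⟨g, hg, -⟩ := h.2 (𝟙 X) (by rw [← h.one_eq, hξ]; exact le_one _)
  exact ⟨g, hg, h.cancel (by rw [← Category.assoc, hg, Category.comp_id, Category.id_comp])⟩

/-- A total pure map is a comprehension. -/
theorem IsPure.isComprehension_of_total [HasQuotients C] {X Y : C} {f : X ⟶ Y} (hf : IsPure f)
    (htot : f ≫ one Y = one X) : ∃ p : Pred Y, IsComprehension f p := by
  obtain ⟨Z, ξ, π, ⟨p, hξ⟩, ⟨q, hπ⟩, rfl⟩ := hf
  obtain ⟨g, h₁, h₂⟩ := hξ.exists_inverse (total_of_comp_total htot)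
  exact ⟨q, hπ.iso_comp h₁ h₂⟩

end Isomorphisms

/-! ### Images, sharp predicates and retractions of comprehensions -/

section Images

variable {C : Type u} [Category.{v} C] [Effectus C]

theorem isSharp_one (X : C) : IsSharp (one X) := by
  refine ⟨X, 𝟙 X, rfl, fun q hq => ?_⟩
  rw [Category.id_comp, Category.id_comp] at hq
  rw [hq]
  exact Le.refl _

theorem IsComprehension.im_le [HasIm C] {E X : C} {π : E ⟶ X} {p : Pred X}
    (h : IsComprehension π p) : Le (im π) p := (isIm_im π).2 p h.1

/-- A map with image `s` factors through `π`, so its image lies below that of `π`. -/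
theorem IsComprehension.im_eq [HasIm C] {E X : C} {π : E ⟶ X} {s : Pred X}
    (h : IsComprehension π s) (hs : IsSharp s) : im π = s := by
  refine Le.antisymm h.im_le ?_
  obtain ⟨Z, g, hg⟩ := hs
  obtain ⟨k, rfl, -⟩ := h.2 g hg.1
  exact hg.2 _ (by rw [Category.assoc, (isIm_im π).1, Category.assoc])

theorem le_ceil [HasComprehension C] [HasIm C] {X : C} (p : Pred X) : Le p (ceil p) := by
  have h := (isComprehension_compr (orth p)).im_le.orth
  rwa [orth_orth] at h

theorem im_iso_comp [HasIm C] {X Y Z : C} {g : X ⟶ Y} {k : Y ⟶ X} (h : k ≫ g = 𝟙 Y) (f : Y ⟶ Z) :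
    im (g ≫ f) = im f := by
  apply Le.antisymm
  · exact (isIm_im (g ≫ f)).2 _ (by rw [Category.assoc, (isIm_im f).1, Category.assoc])
  · refine (isIm_im f).2 _ ?_
    have h' := congrArg (k ≫ ·) (isIm_im (g ≫ f)).1
    simpa only [Category.assoc, ← Category.assoc k, h, Category.id_comp] using h'

/-- This is `◇`-adjointness evaluated at the sharp predicate `1`, whose comprehension is invertible
and so does not affect the image. It is the only consequence of `◇`-adjointness needed for the
dagger. -/
theorem DiaAdjoint.ceil_eq_im [IsDiamondEffectus C] {X Y : C} {f : X ⟶ Y} {g : Y ⟶ X}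
    (h : DiaAdjoint f g) : ceil (f ≫ one Y) = im g := by
  have h₁ : ceil (f ≫ one Y) = im (compr (one Y) ≫ g) :=
    congrArg Subtype.val (congrFun h ⟨one Y, isSharp_one Y⟩)
  obtain ⟨k, -, hk⟩ := (isComprehension_compr (one Y)).exists_inverse
  rw [h₁, im_iso_comp hk]

/-- A quotient for the complement of the image of a comprehension `π` becomes a retraction
of `π` after composition with an isomorphism. -/
theorem exists_quotient_comp_iso_retraction [IsAndthenEffectus C] {E X Q : C} {π : E ⟶ X}
    {p : Pred X} (h : IsComprehension π p) {ξ : X ⟶ Q} (hξ : IsQuotient ξ (orth (im π))) :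
    ∃ (a : Q ⟶ E) (b : E ⟶ Q), a ≫ b = 𝟙 Q ∧ b ≫ a = 𝟙 E ∧ π ≫ ξ ≫ a = 𝟙 E := by
  have hone : ξ ≫ one Q = im π := by rw [hξ.one_eq, orth_orth]
  obtain ⟨Z, ξ', π', ⟨p', hξ'⟩, ⟨q', hπ'⟩, hfac⟩ :=
    IsAndthenEffectus.isPure_comprehension_comp_quotient π ξ p _ h hξ
  -- Both factors of the pure map `π ≫ ξ` are invertible. The quotient factor is, because `π ≫ ξ` is
  -- total: `1 ∘ ξ = im π`.
  obtain ⟨k, hk₁, hk₂⟩ := hξ'.exists_inverse (by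
    rw [← hπ'.total, ← Category.assoc, ← hfac, Category.assoc, hone, (isIm_im π).1, h.total])
  -- For the comprehension factor, minimality of `im π` gives `im π ≤ q' ∘ ξ`, so `q' = 1` after
  -- cancelling `ξ`.
  have hq : ξ ≫ q' = ξ ≫ one Q := by
    apply Le.antisymm ((le_one q').comp ξ)
    rw [hone]
    refine (isIm_im π).2 _ ?_
    rw [← Category.assoc, hfac, Category.assoc, hπ'.1, ← Category.assoc, ← hfac,
      Category.assoc, hone, (isIm_im π).1]
  rw [hξ.cancel hq] at hπ'
  obtain ⟨m, hm₁, hm₂⟩ := hπ'.exists_inverse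
  refine ⟨m ≫ k, ξ' ≫ π', ?_, ?_, ?_⟩
  · rw [Category.assoc, ← Category.assoc k, hk₂, Category.id_comp, hm₂]
  · rw [Category.assoc, ← Category.assoc π', hm₁, Category.id_comp, hk₁]
  · rw [← Category.assoc, hfac, Category.assoc, ← Category.assoc π', hm₁, Category.id_comp, hk₁]

end Images

/-! ### The dagger of comprehensions and quotients -/

section DaggerEffectus

variable {C : Type u} [Category.{v} C] [Effectus C] [DaggerEffectus C]

theorem DaggerPositive.dagger_eq {D : Type u} [Category.{v} D] [DaggerCategory D] {X : D}
    {f : X ⟶ X} (h : DaggerPositive f) : dagger f = f := by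
  obtain ⟨Y, g, rfl⟩ := h
  rw [dagger_comp, dagger_dagger]

/-- The `†`-positive square root equals its dagger, to which it is `◇`-adjoint. -/
theorem DaggerPositive.diaPositive {X : PureCat C} {f : X ⟶ X} (h : DaggerPositive f) :
    DiaPositive f.hom := by
  obtain ⟨g, ⟨hg, rfl⟩, -⟩ := DaggerEffectus.existsUnique_sqrt f h
  refine ⟨(g ≫ g).property, g.hom, ?_, rfl⟩
  have h' := DaggerEffectus.diaAdjoint_dagger g
  rwa [hg.dagger_eq] at h'

/-- The identity is the only total `†`-positive endomap. -/
theorem DaggerPositive.eq_id {X : PureCat C} {f : X ⟶ X} (h : DaggerPositive f)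
    (hf : f.hom ≫ one X.obj = one X.obj) : f = 𝟙 X := by
  have hid : DaggerPositive (𝟙 X) := ⟨X, 𝟙 X, by rw [dagger_id, Category.comp_id]⟩
  apply WideSubcategory.hom_ext
  exact (IsAndthenEffectus.existsUnique_asrt (one X.obj)).unique ⟨h.diaPositive, hf⟩
    ⟨hid.diaPositive, Category.id_comp _⟩

theorem comp_hom {X Y Z : PureCat C} (f : X ⟶ Y) (g : Y ⟶ Z) : (f ≫ g).hom = f.hom ≫ g.hom := rfl

/-- Adjointness alone only yields `⌈1 ∘ π†⌉ = im π`, hence one inequality. For the other, a pure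
retraction `ζ` of `π` gives `im π ≤ 1 ∘ ζ ≤ ⌈1 ∘ ζ⌉ = im ζ†`, and `im ζ† ≤ 1 ∘ π†` because `π† ∘ ζ†
= id` makes `1 ∘ π†` true on `ζ†`. -/
theorem dagger_comp_one_of_isComprehension {E X : PureCat C} (π : E ⟶ X) {p : Pred X.obj}
    (h : IsComprehension π.hom p) : (dagger π).hom ≫ one E.obj = im π.hom := by
  apply Le.antisymm
  · have h₁ := (DaggerEffectus.diaAdjoint_dagger (dagger π)).ceil_eq_im
    rw [dagger_dagger] at h₁
    rw [← h₁]
    exact le_ceil _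
  · obtain ⟨Q, ξ, hξ⟩ := HasQuotients.exists_quotient (orth (im π.hom))
    obtain ⟨a, b, hab, hba, ha⟩ := exists_quotient_comp_iso_retraction h hξ
    let ζ : X ⟶ E := PureCat.homMk (ξ ≫ a) (hξ.comp_iso hab hba).isPure
    have hζ : π ≫ ζ = 𝟙 E := WideSubcategory.hom_ext _ ha
    have hζ' : (dagger ζ).hom ≫ (dagger π).hom = 𝟙 E.obj := by
      rw [← comp_hom, ← dagger_comp, hζ, dagger_id]; rfl
    have h₁ : Le (im π.hom) (ζ.hom ≫ one E.obj) := by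
      refine (isIm_im _).2 _ ?_
      have : π.hom ≫ ζ.hom = 𝟙 E.obj := ha
      rw [← Category.assoc, this, Category.id_comp, h.total]
    have h₂ := (DaggerEffectus.diaAdjoint_dagger ζ).ceil_eq_im
    refine (h₁.trans (le_ceil _)).trans ?_
    rw [h₂]
    refine (isIm_im _).2 _ ?_
    rw [← Category.assoc, hζ', Category.id_comp]
    exact (total_of_comp_total (g := (dagger π).hom) (by rw [hζ', Category.id_comp])).symm

theorem daggerMono_of_isComprehension {E X : PureCat C} (π : E ⟶ X) {p : Pred X.obj}
    (h : IsComprehension π.hom p) : DaggerMono π := by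
  refine DaggerPositive.eq_id ⟨X, π, rfl⟩ ?_
  rw [comp_hom, Category.assoc, dagger_comp_one_of_isComprehension π h, (isIm_im _).1, h.total]

theorem daggerMono_iff_isComprehension {X Y : PureCat C} (f : X ⟶ Y) :
    DaggerMono f ↔ ∃ p : Pred Y.obj, IsComprehension f.hom p := by
  refine ⟨fun h => f.property.isComprehension_of_total ?_,
    fun ⟨p, hp⟩ => daggerMono_of_isComprehension f hp⟩
  have h' : f.hom ≫ (dagger f).hom = 𝟙 X.obj := congrArg (·.hom) h
  exact total_of_comp_total (g := (dagger f).hom) (by rw [h', Category.id_comp])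

/-- The dagger of a comprehension `π` is a retraction of `π` obtained from any quotient for the
complement of the image of `π`. -/
theorem dagger_eq_quotient_comp_iso {E X : PureCat C} (π : E ⟶ X) {p : Pred X.obj}
    (h : IsComprehension π.hom p) {Q : C} {ξ : X.obj ⟶ Q}
    (hξ : IsQuotient ξ (orth (im π.hom))) :
    ∃ (a : Q ⟶ E.obj) (b : E.obj ⟶ Q), a ≫ b = 𝟙 Q ∧ b ≫ a = 𝟙 E.obj ∧
      (dagger π).hom = ξ ≫ a := by
  obtain ⟨a, b, hab, hba, ha⟩ := exists_quotient_comp_iso_retraction h hξ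
  refine ⟨a, b, hab, hba, ?_⟩
  -- Since `1 ∘ π† = im π`, the dagger factors through the quotient retraction; as both are
  -- retractions of `π`, the mediating map `k` is the identity.
  obtain ⟨k, hk, -⟩ := (hξ.comp_iso hab hba).2 (dagger π).hom (by
    rw [dagger_comp_one_of_isComprehension π h, orth_orth]; exact Le.refl _)
  have h₁ : π.hom ≫ (dagger π).hom = 𝟙 E.obj :=
    congrArg (·.hom) (daggerMono_of_isComprehension π h)
  rw [← hk, ← Category.assoc, ha, Category.id_comp] at h₁
  rw [← hk, h₁, Category.comp_id]

theorem daggerMono_dagger_iff {X Y : PureCat C} (f : X ⟶ Y) :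
    DaggerMono (dagger f) ↔ DaggerEpi f := by
  rw [DaggerMono, DaggerEpi, dagger_dagger]

/-- Both directions exploit that the dagger of a comprehension is, up to isomorphism, any quotient
for the complement of its image. Sharpness enters because images and their complements are sharp. -/
theorem daggerEpi_iff_isQuotient {X Y : PureCat C} (f : X ⟶ Y) :
    DaggerEpi f ↔ ∃ s : Pred X.obj, IsSharp s ∧ IsQuotient f.hom s := by
  constructor
  · intro h
    obtain ⟨p, hp⟩ := (daggerMono_iff_isComprehension _).1 ((daggerMono_dagger_iff f).2 h)
    obtain ⟨Q, ξ, hξ⟩ := HasQuotients.exists_quotient (orth (im (dagger f).hom))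
    obtain ⟨a, b, hab, hba, ha⟩ := dagger_eq_quotient_comp_iso _ hp hξ
    rw [dagger_dagger] at ha
    exact ⟨_, IsDiamondEffectus.isSharp_orth _ (isSharp_im _), ha ▸ hξ.comp_iso hab hba⟩
  · rintro ⟨s, hs, hf⟩
    let E : PureCat C := ⟨comprObj (orth s)⟩
    have hπ := isComprehension_compr (orth s)
    let π : E ⟶ X := PureCat.homMk (compr (orth s)) hπ.isPure
    have him : im π.hom = orth s := hπ.im_eq (IsDiamondEffectus.isSharp_orth s hs)
    obtain ⟨a, b, hab, hba, ha⟩ := dagger_eq_quotient_comp_iso π hπ (ξ := f.hom)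
      (by rw [him, orth_orth]; exact hf)
    let β : E ⟶ Y := PureCat.homMk b (isComprehension_of_inverse hba hab).isPure
    let α : Y ⟶ E := PureCat.homMk a (isComprehension_of_inverse hab hba).isPure
    have hαβ : α ≫ β = 𝟙 Y := WideSubcategory.hom_ext _ hab
    -- An isomorphism is a comprehension, hence `†`-mono, so its dagger is its inverse.
    have hβ : β ≫ dagger β = 𝟙 E :=
      daggerMono_of_isComprehension β (isComprehension_of_inverse hba hab)
    have hβ' : dagger β ≫ β = 𝟙 Y := by
      have : dagger β = α := by
        rw [← Category.id_comp (dagger β), ← hαβ, Category.assoc, hβ, Category.comp_id]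
      rw [this, hαβ]
    have hπ' : π ≫ dagger π = 𝟙 E := daggerMono_of_isComprehension π hπ
    have hfβ : f = dagger π ≫ β := by
      have : dagger π = f ≫ α := WideSubcategory.hom_ext _ ha
      rw [this, Category.assoc, hαβ, Category.comp_id]
    rw [DaggerEpi, hfβ, dagger_comp, dagger_dagger, Category.assoc, ← Category.assoc π, hπ',
      Category.id_comp, hβ']

theorem daggerPartialIsometry_iff_isPristine {X Y : PureCat C} (f : X ⟶ Y) :
    DaggerPartialIsometry f ↔ IsPristine f.hom := by
  constructor
  · rintro ⟨Z, e, m, he, hm, rfl⟩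
    obtain ⟨s, hs, he'⟩ := (daggerEpi_iff_isQuotient e).1 he
    obtain ⟨p, hp⟩ := (daggerMono_iff_isComprehension m).1 hm
    refine ⟨(e ≫ m).property, ?_⟩
    rw [comp_hom, Category.assoc, hp.total, he'.one_eq]
    exact IsDiamondEffectus.isSharp_orth s hs
  · rintro ⟨⟨Z, ξ, π, ⟨p, hξ⟩, ⟨q, hπ⟩, hf⟩, hs⟩
    rw [hf, Category.assoc, hπ.total, hξ.one_eq] at hs
    have hp : IsSharp p := by
      rw [← orth_orth p]
      exact IsDiamondEffectus.isSharp_orth _ hs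
    let Z' : PureCat C := ⟨Z⟩
    let e : X ⟶ Z' := PureCat.homMk ξ hξ.isPure
    let m : Z' ⟶ Y := PureCat.homMk π hπ.isPure
    exact ⟨Z', e, m, (daggerEpi_iff_isQuotient e).2 ⟨p, hp, hξ⟩,
      (daggerMono_iff_isComprehension m).2 ⟨q, hπ⟩, WideSubcategory.hom_ext _ hf⟩

end DaggerEffectus

/-! ### The zero object of the category of pure maps -/

section ZeroObject

variable {C : Type u} [Category.{v} C] [Effectus C]

theorem eq_zero_of_isInitial {Z : C} (hZ : IsInitial Z) {X : C} (f : X ⟶ Z) : f = PCM.zero := by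
  rw [← Category.comp_id f, hZ.hom_ext (𝟙 Z) PCM.zero, comp_zero]

theorem isQuotient_zero {Z : C} (hZ : IsInitial Z) (X : C) :
    IsQuotient (PCM.zero : X ⟶ Z) (one X) := by
  have h0 : orth (one X) = (PCM.zero : Pred X) := by rw [← orth_zero, orth_orth]
  refine ⟨?_, fun f hf => ⟨hZ.to _, ?_, fun _ _ => hZ.hom_ext _ _⟩⟩
  · rw [zero_comp, h0]
    exact Le.refl _
  · obtain ⟨c, hc⟩ := hf
    rw [h0] at hc
    rw [Effectus.eq_zero_of_comp_one f (eq_zero_of_ovee_eq_zero (PCM.ovee_comm _ _ _ hc))]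
    exact zero_comp _

theorem isComprehension_zero {Z : C} (hZ : IsInitial Z) (X : C) :
    IsComprehension (PCM.zero : Z ⟶ X) (PCM.zero : Pred X) := by
  refine ⟨hZ.hom_ext _ _, fun g hg => ⟨PCM.zero, ?_, fun y _ => eq_zero_of_isInitial hZ y⟩⟩
  rw [comp_zero_pred] at hg
  rw [Effectus.eq_zero_of_comp_one g hg.symm]
  exact zero_comp _

variable [IsAndthenEffectus C]

/-- On an initial object the identity is `0`, so all maps into it vanish too. The zero maps into and
out of it are pure, being a quotient for `1` and a comprehension for `0`. -/
theorem isZero_pureCat {Z : C} (hZ : IsInitial Z) : IsZero (⟨Z⟩ : PureCat C) where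
  unique_to Y := ⟨⟨⟨PureCat.homMk PCM.zero (isComprehension_zero hZ Y.obj).isPure⟩,
    fun _ => WideSubcategory.hom_ext _ (hZ.hom_ext _ _)⟩⟩
  unique_from Y := ⟨⟨⟨PureCat.homMk PCM.zero (isQuotient_zero hZ Y.obj).isPure⟩,
    fun _ => WideSubcategory.hom_ext _ (eq_zero_of_isInitial hZ _)⟩⟩

theorem exists_isZeroMap (X Y : PureCat C) :
    ∃ z : X ⟶ Y, IsZeroMap z ∧ z.hom = PCM.zero := by
  have hZ : IsInitial (⊥_ C) := initialIsInitial
  refine ⟨(isZero_pureCat hZ).from_ X ≫ (isZero_pureCat hZ).to_ Y,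
    ⟨_, _, _, isZero_pureCat hZ, rfl⟩, ?_⟩
  rw [show ((isZero_pureCat hZ).from_ X ≫ (isZero_pureCat hZ).to_ Y).hom =
    ((isZero_pureCat hZ).from_ X).hom ≫ ((isZero_pureCat hZ).to_ Y).hom from rfl,
    eq_zero_of_isInitial hZ ((isZero_pureCat hZ).from_ X).hom, zero_comp]

end ZeroObject

/-! ### Dagger kernels from comprehensions -/

section DaggerKernels

variable {C : Type u} [Category.{v} C] [Effectus C] [DaggerEffectus C]

theorem isDaggerKernel_of_isComprehension {K X Y : PureCat C} (f : X ⟶ Y) (π : K.obj ⟶ X.obj)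
    (hπ : IsComprehension π (orth (f.hom ≫ one Y.obj))) :
    IsDaggerKernel f (PureCat.homMk π hπ.isPure) := by
  have hm : DaggerMono (PureCat.homMk π hπ.isPure) := daggerMono_of_isComprehension _ hπ
  obtain ⟨z, hz, hz0⟩ := exists_isZeroMap X Y
  have hzero : π ≫ f.hom = PCM.zero := by
    apply Effectus.eq_zero_of_comp_one
    rw [Category.assoc]
    exact (comp_orth_eq_one_iff π (f.hom ≫ one Y.obj)).1 hπ.1
  have w : PureCat.homMk π hπ.isPure ≫ f = PureCat.homMk π hπ.isPure ≫ z := by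
    apply WideSubcategory.hom_ext
    rw [comp_hom, comp_hom, hz0, comp_zero]
    exact hzero
  -- The universal property of `π` in `C` yields a factorization `g` that is not known to be pure.
  -- Since `π† ∘ π = id`, it equals `π†` after `s.ι`, so this pure composite is used as the lift.
  refine ⟨hm, z, hz, w, ⟨Fork.IsLimit.mk' _ fun s =>
    ⟨s.ι ≫ dagger (PureCat.homMk π hπ.isPure), ?_, fun {l} hl => ?_⟩⟩⟩
  · have hs : s.ι.hom ≫ f.hom = PCM.zero := by
      rw [← comp_hom, s.condition, comp_hom, hz0, comp_zero]
    obtain ⟨g, hg, -⟩ := hπ.2 s.ι.hom ((comp_orth_eq_one_iff _ _).2 (by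
      rw [← Category.assoc, hs, zero_comp]))
    have hm' : π ≫ (dagger (PureCat.homMk π hπ.isPure)).hom = 𝟙 K.obj := congrArg (·.hom) hm
    apply WideSubcategory.hom_ext
    show (s.ι.hom ≫ (dagger (PureCat.homMk π hπ.isPure)).hom) ≫ π = s.ι.hom
    rw [← hg, Category.assoc g, hm', Category.comp_id]
  · rw [← hl, Category.assoc]
    exact ((congrArg (l ≫ ·) hm).trans (Category.comp_id l)).symm

theorem isDaggerKernelCategory_pureCat : IsDaggerKernelCategory (PureCat C) :=
  ⟨⟨⟨_, isZero_pureCat (initialIsInitial (C := C))⟩⟩, fun {_ Y} f =>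
    ⟨⟨comprObj (orth (f.hom ≫ one Y.obj))⟩, _,
      isDaggerKernel_of_isComprehension f _ (isComprehension_compr _)⟩⟩

end DaggerKernels

end EffectusTheory

theorem mainTheorem10 {C : Type u} [Category.{v} C] [Effectus C] [DaggerEffectus C] :
    (∀ {X Y : PureCat C} (f : X ⟶ Y),
      DaggerMono f ↔ ∃ p : Pred Y.obj, IsComprehension f.hom p) ∧
    (∀ {X Y : PureCat C} (f : X ⟶ Y),
      DaggerEpi f ↔ ∃ s : Pred X.obj, IsSharp s ∧ IsQuotient f.hom s) ∧
    (∀ {X Y : PureCat C} (f : X ⟶ Y),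
      DaggerPartialIsometry f ↔ IsPristine f.hom) ∧
    IsDaggerKernelCategory (PureCat C) ∧
    (∀ {K X Y : PureCat C} (f : X ⟶ Y) (π : K.obj ⟶ X.obj)
      (hπ : IsComprehension π (orth (f.hom ≫ one Y.obj))),
      IsDaggerKernel f (PureCat.homMk π hπ.isPure)) :=
  ⟨daggerMono_iff_isComprehension, daggerEpi_iff_isQuotient, daggerPartialIsometry_iff_isPristine,
    isDaggerKernelCategory_pureCat, isDaggerKernel_of_isComprehension⟩
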